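/- Let $2\le g\le n-1$. All digraphs are finite and simple (no loops, no multiple arcs). For a digraph $D$ on $n$ vertices let $A(D)$ be its adjacency matrix, $\mathrm{diag}(D)$ the diagonal matrix of outdegrees, $Q(D)=\mathrm{diag}(D)+A(D)$, and let $q(D)$ be the spectral radius of $Q(D)$, i.e. the largest modulus of its complex eigenvalues. Let $C_{n,g}$ be the digraph with vertex set $\{u_1,\dots,u_n\}$ and arc set $\{(u_i,u_{i+1}) : 1\le i\le n-1\}\cup\{(u_g,u_1),(u_n,u_1)\}$. Then every strongly connected digraph $D$ on $n$ vertices with girth $g$ (the length of its shortest directed cycle) satisfies $q(D)\ge q(C_{n,g})>2$, and $q(D)=q(C_{n,g})$ if and only if $D\cong C_{n,g}$. -/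

import Mathlib

namespace Digraph

variable {V : Type*}

/-- A digraph (no multiple arcs, by the definition of `Digraph`) is simple if it has no loops. -/
def IsSimple (D : Digraph V) : Prop := ∀ v, ¬ D.Adj v v

/-- Strong connectivity: every vertex can be reached from every vertex along arcs. -/
def IsStronglyConnected (D : Digraph V) : Prop :=
  ∀ u v : V, Relation.ReflTransGen D.Adj u v

/-- `D` has a directed cycle of length `k`: there are `k ≥ 1` distinct vertices
`c 0, …, c (k - 1)` with arcs `c 0 → c 1 → ⋯ → c (k - 1) → c 0`. -/
def HasDirectedCycle (D : Digraph V) (k : ℕ) : Prop :=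
  1 ≤ k ∧ ∃ c : Fin k → V, Function.Injective c ∧ ∀ i, D.Adj (c i) (c (finRotate k i))

/-- The girth: the length of a shortest directed cycle (with value `0` if there is none). -/
noncomputable def girth (D : Digraph V) : ℕ := sInf {k | D.HasDirectedCycle k}

/-- The outdegree of a vertex. -/
noncomputable def outDegree (D : Digraph V) (v : V) : ℕ := {w | D.Adj v w}.ncard

open Classical in
/-- The adjacency matrix. -/
noncomputable def adjMatrix (D : Digraph V) : Matrix V V ℝ :=
  Matrix.of fun i j => if D.Adj i j then 1 else 0

open Classical in
/-- The signless Laplacian matrix `Q(D) = diag(D) + A(D)`. -/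
noncomputable def signlessLaplacian (D : Digraph V) : Matrix V V ℝ :=
  Matrix.diagonal (fun v => (D.outDegree v : ℝ)) + D.adjMatrix

open Classical in
/-- The signless Laplacian spectral radius `q(D)`: the largest modulus of a complex eigenvalue
of `Q(D)`. -/
noncomputable def q [Fintype V] (D : Digraph V) : ℝ :=
  (spectralRadius ℂ (D.signlessLaplacian.map (algebraMap ℝ ℂ))).toReal

/-- The digraph `C_{n,g}`, with the vertex `u_{i+1}` written as `i : Fin n`: its arcs are
`u_i → u_{i+1}` for `1 ≤ i ≤ n - 1`, `u_g → u_1` and `u_n → u_1`. -/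
def cycleWithPath (n g : ℕ) : Digraph (Fin n) where
  Adj i j := (j : ℕ) = i + 1 ∨ ((i : ℕ) + 1 = g ∧ (j : ℕ) = 0) ∨ ((i : ℕ) + 1 = n ∧ (j : ℕ) = 0)

end Digraph

/-!
Let `t > 1` solve `t⁻¹ ^ (g - 1) + t⁻¹ ^ (n - 1) = t - 1`. Numbering the vertices of `C_{n,g}` by
their distance to the vertex of outdegree two, `i ↦ t⁻¹ ^ i` is a positive eigenvector of the
signless Laplacian with eigenvalue `t + 1`, so `q(C_{n,g}) = t + 1 > 2` by the Collatz–Wielandt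
bounds (`le_spectralRadius_of_smul_le_mulVec`, `spectralRadius_le_of_mulVec_le_smul`).

For a strongly connected `D` with a cycle of length `g < n`, some vertex `v` of the cycle has, besides
its successor `a` on the cycle, another out-neighbour `b` (`exists_branch_of_cycle`). The vector
`y w = t⁻¹ ^ dist(w, v)` satisfies `(t + 1) y ≤ Q(D) y`: an entry of `Q(D) y` at `w` is the sum of
`y w + y x` over the out-neighbours `x` of `w`; for `w ≠ v` one of these is nearer to `v`, hence
contributes `y w + t * y w`; and at `v` the out-neighbours `a` and `b` suffice, because
`dist(a, v) ≤ g - 1` and `dist(b, v) ≤ n - 1`. This gives `t + 1 ≤ q(D)`.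

Since `Q(D)` is irreducible with positive diagonal, `q(D) = t + 1` forces `Q(D) y = (t + 1) y`
(`lt_spectralRadius_of_smul_lt_mulVec`). Then there are no arcs other than those just used and
`dist(b, v) = n - 1`, so the distances to `v` number the vertices bijectively by `0, …, n - 1`, and
`D` is `C_{n,g}` (`nonempty_iso_of_inv_pow_distTo_eq`).
-/

/-! ### Collatz–Wielandt bounds for nonnegative matrices -/

section CollatzWielandt

variable {V : Type*} [Fintype V]

open Matrix

theorem mulVec_mono_of_nonneg {M : Matrix V V ℝ} (hM : ∀ i j, 0 ≤ M i j) {x y : V → ℝ}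
    (hxy : x ≤ y) : M *ᵥ x ≤ M *ᵥ y := fun i =>
  Finset.sum_le_sum fun j _ => mul_le_mul_of_nonneg_left (hxy j) (hM i j)

theorem pow_smul_le_pow_mulVec [DecidableEq V] {M : Matrix V V ℝ} (hM : ∀ i j, 0 ≤ M i j)
    {y : V → ℝ} {s : ℝ} (hs : 0 ≤ s) (h : s • y ≤ M *ᵥ y) (k : ℕ) :
    s ^ k • y ≤ M ^ k *ᵥ y := by
  induction k with
  | zero => simp
  | succ k ih =>
    calc s ^ (k + 1) • y = s ^ k • (s • y) := by rw [smul_smul, pow_succ]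
      _ ≤ s ^ k • (M *ᵥ y) := smul_le_smul_of_nonneg_left h (pow_nonneg hs k)
      _ = M *ᵥ (s ^ k • y) := (mulVec_smul _ _ _).symm
      _ ≤ M *ᵥ (M ^ k *ᵥ y) := mulVec_mono_of_nonneg hM ih
      _ = M ^ (k + 1) *ᵥ y := by rw [mulVec_mulVec, pow_succ']

attribute [local instance] Matrix.linftyOpNormedRing Matrix.linftyOpNormedAlgebra

theorem spectralRadius_complex_lt_top [DecidableEq V] (A : Matrix V V ℂ) :
    spectralRadius ℂ A < ⊤ := by
  refine (spectrum.spectralRadius_le_pow_nnnorm_pow_one_div ℂ A 0).trans_lt ?_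
  simp [ENNReal.mul_lt_top_iff]

theorem le_opNorm_pow_of_smul_le_mulVec [DecidableEq V] {M : Matrix V V ℝ}
    (hM : ∀ i j, 0 ≤ M i j) {y : V → ℝ} (hy : 0 ≤ y) (hy0 : y ≠ 0) {s : ℝ} (hs : 0 ≤ s)
    (h : s • y ≤ M *ᵥ y) (k : ℕ) : s ^ k ≤ ‖(M.map (algebraMap ℝ ℂ)) ^ k‖ := by
  have hmap : (M.map (algebraMap ℝ ℂ)) ^ k = (M ^ k).map (algebraMap ℝ ℂ) :=
    (map_pow (algebraMap ℝ ℂ).mapMatrix M k).symm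
  have hnorm : ‖(M.map (algebraMap ℝ ℂ)) ^ k‖ = ‖M ^ k‖ := by
    rw [hmap]
    simp [linfty_opNorm_def]
  have hk := pow_smul_le_pow_mulVec hM hs h k
  have hle : ‖s ^ k • y‖ ≤ ‖M ^ k *ᵥ y‖ := by
    refine (pi_norm_le_iff_of_nonneg (norm_nonneg _)).2 fun i => ?_
    refine le_trans ?_ (norm_le_pi_norm _ i)
    have h0 : 0 ≤ (s ^ k • y) i := mul_nonneg (pow_nonneg hs k) (hy i)
    rw [Real.norm_of_nonneg h0]
    exact (hk i).trans (le_abs_self _)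
  rw [hnorm]
  refine le_of_mul_le_mul_right ?_ (norm_pos_iff.2 hy0)
  calc s ^ k * ‖y‖ = ‖s ^ k • y‖ := by rw [norm_smul, Real.norm_of_nonneg (pow_nonneg hs k)]
    _ ≤ ‖M ^ k *ᵥ y‖ := hle
    _ ≤ ‖M ^ k‖ * ‖y‖ := linfty_opNorm_mulVec _ _

/-- The lower Collatz–Wielandt bound: the powers of `M` grow at least like those of `s` along `y`,
so the bound follows from Gelfand's formula. -/
theorem le_spectralRadius_of_smul_le_mulVec [DecidableEq V] {M : Matrix V V ℝ}
    (hM : ∀ i j, 0 ≤ M i j) {y : V → ℝ} (hy : 0 ≤ y) (hy0 : y ≠ 0) {s : ℝ} (hs : 0 ≤ s)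
    (h : s • y ≤ M *ᵥ y) :
    s ≤ (spectralRadius ℂ (M.map (algebraMap ℝ ℂ))).toReal := by
  have hlim := spectrum.pow_norm_pow_one_div_tendsto_nhds_spectralRadius (M.map (algebraMap ℝ ℂ))
  rw [← ENNReal.ofReal_le_iff_le_toReal (spectralRadius_complex_lt_top _).ne]
  refine ge_of_tendsto hlim ?_
  filter_upwards [Filter.eventually_gt_atTop 0] with k hk
  refine ENNReal.ofReal_le_ofReal ?_
  calc s = (s ^ k) ^ (1 / k : ℝ) := by
        rw [one_div, Real.pow_rpow_inv_natCast hs hk.ne']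
    _ ≤ _ := Real.rpow_le_rpow (pow_nonneg hs k)
        (le_opNorm_pow_of_smul_le_mulVec hM hy hy0 hs h k) (by positivity)

/-- The upper Collatz–Wielandt bound: compare an eigenvector `z` with `y` at an index maximizing
`‖z i‖ / y i`. -/
theorem spectralRadius_le_of_mulVec_le_smul [DecidableEq V] {M : Matrix V V ℝ}
    (hM : ∀ i j, 0 ≤ M i j) {y : V → ℝ} (hy : ∀ i, 0 < y i) {s : ℝ} (hs : 0 ≤ s)
    (h : M *ᵥ y ≤ s • y) :
    (spectralRadius ℂ (M.map (algebraMap ℝ ℂ))).toReal ≤ s := by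
  refine ENNReal.toReal_le_of_le_ofReal hs ?_
  refine iSup₂_le fun μ hμ => ?_
  rw [← enorm_eq_nnnorm, ← ofReal_norm]
  refine ENNReal.ofReal_le_ofReal ?_
  rw [← Matrix.spectrum_toLin', ← Module.End.hasEigenvalue_iff_mem_spectrum] at hμ
  obtain ⟨z, hz⟩ := hμ.exists_hasEigenvector
  have hzeq : (M.map (algebraMap ℝ ℂ)) *ᵥ z = μ • z := by simpa using hz.apply_eq_smul
  obtain ⟨j₀, hj₀⟩ := Function.ne_iff.1 hz.2
  have : Nonempty V := ⟨j₀⟩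
  obtain ⟨i, -, hi⟩ := Finset.exists_max_image Finset.univ (fun i => ‖z i‖ / y i)
    Finset.univ_nonempty
  set c := ‖z i‖ / y i with hc
  have hzc : ∀ j, ‖z j‖ ≤ c * y j := fun j => (div_le_iff₀ (hy j)).1 (hi j (Finset.mem_univ j))
  have hcpos : 0 < c :=
    lt_of_lt_of_le (div_pos (norm_pos_iff.2 hj₀) (hy j₀)) (hi j₀ (Finset.mem_univ j₀))
  have hci : ‖z i‖ = c * y i := by rw [hc, div_mul_cancel₀ _ (hy i).ne']
  refine le_of_mul_le_mul_right ?_ (mul_pos hcpos (hy i))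
  calc ‖μ‖ * (c * y i) = ‖((M.map (algebraMap ℝ ℂ)) *ᵥ z) i‖ := by
        rw [hzeq, Pi.smul_apply, smul_eq_mul, norm_mul, hci]
    _ ≤ ∑ j, ‖(M.map (algebraMap ℝ ℂ)) i j * z j‖ := norm_sum_le _ _
    _ ≤ ∑ j, c * (M i j * y j) := Finset.sum_le_sum fun j _ => by
        rw [norm_mul]
        have : ‖(M.map (algebraMap ℝ ℂ)) i j‖ = M i j := by simp [abs_of_nonneg (hM i j)]
        rw [this]
        nlinarith [mul_le_mul_of_nonneg_left (hzc j) (hM i j)]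
    _ = c * (M *ᵥ y) i := (Finset.mul_sum _ _ _).symm
    _ ≤ c * (s * y i) := mul_le_mul_of_nonneg_left (h i) hcpos.le
    _ = s * (c * y i) := by ring

/-- If the positive entries of `M` form a strongly connected relation that contains the diagonal, one
strict inequality in `s • y ≤ M *ᵥ y` spreads to all coordinates under iteration of `M`, which
makes the Collatz–Wielandt bound strict. -/
theorem lt_spectralRadius_of_smul_lt_mulVec [DecidableEq V] {M : Matrix V V ℝ}
    (hM : ∀ i j, 0 ≤ M i j) (hdiag : ∀ i, 0 < M i i)
    (hirr : ∀ i j, Relation.ReflTransGen (fun a b => 0 < M a b) i j)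
    {y : V → ℝ} (hy : ∀ i, 0 < y i) {s : ℝ} (hs : 0 ≤ s)
    (h : s • y ≤ M *ᵥ y) {w : V} (hw : s * y w < (M *ᵥ y) w) :
    s < (spectralRadius ℂ (M.map (algebraMap ℝ ℂ))).toReal := by
  set r : V → ℝ := M *ᵥ y - s • y with hr
  have hr0 : 0 ≤ r := sub_nonneg.2 h
  have hrw : 0 < r w := sub_pos.2 hw
  have hnn : ∀ k, 0 ≤ M ^ k *ᵥ r := fun k => by
    induction k with
    | zero => simpa using hr0
    | succ k ih =>
      rw [pow_succ', ← mulVec_mulVec]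
      simpa using mulVec_mono_of_nonneg hM ih
  have hstep : ∀ k a b, 0 < M a b → 0 < (M ^ k *ᵥ r) b → 0 < (M ^ (k + 1) *ᵥ r) a := by
    intro k a b hab hb
    rw [pow_succ', ← mulVec_mulVec]
    exact Finset.sum_pos' (fun j _ => mul_nonneg (hM a j) (hnn k j))
      ⟨b, Finset.mem_univ b, mul_pos hab hb⟩
  have hex : ∀ u, ∃ k, 0 < (M ^ k *ᵥ r) u := fun u => by
    induction hirr u w using Relation.ReflTransGen.head_induction_on with
    | refl => exact ⟨0, by simpa using hrw⟩
    | head hab _ ih => exact ih.elim fun k hk => ⟨k + 1, hstep k _ _ hab hk⟩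
  have hmono : ∀ u k l, k ≤ l → 0 < (M ^ k *ᵥ r) u → 0 < (M ^ l *ᵥ r) u := by
    intro u k l hkl hk
    induction l, hkl using Nat.le_induction with
    | base => exact hk
    | succ l _ ih => exact hstep l u u (hdiag u) ih
  -- As the diagonal is positive, coordinates stay positive, so one power of `M` serves all of them.
  choose κ hκ using hex
  set N := Finset.univ.sup κ
  have hpos : ∀ u, 0 < (M ^ N *ᵥ r) u := fun u =>
    hmono u _ _ (Finset.le_sup (Finset.mem_univ u)) (hκ u)
  set z := M ^ N *ᵥ y with hz
  have hzr : ∀ u, (M *ᵥ z) u = s * z u + (M ^ N *ᵥ r) u := fun u => by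
    have : M ^ N *ᵥ r = M *ᵥ z - s • z := by
      rw [hr, mulVec_sub, mulVec_smul, mulVec_mulVec, hz, mulVec_mulVec, (Commute.pow_self M N).eq]
    rw [this]; simp
  have hznn : ∀ u, 0 < z u := by
    have key : ∀ k u, 0 < (M ^ k *ᵥ y) u := fun k => by
      induction k with
      | zero => simpa using hy
      | succ k ih =>
        intro u
        rw [pow_succ', ← mulVec_mulVec]
        exact Finset.sum_pos' (fun j _ => mul_nonneg (hM u j) (ih j).le)
          ⟨u, Finset.mem_univ u, mul_pos (hdiag u) (ih u)⟩
    exact key N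
  have : Nonempty V := ⟨w⟩
  obtain ⟨i, -, hi⟩ := Finset.exists_min_image Finset.univ (fun i => (M ^ N *ᵥ r) i / z i)
    Finset.univ_nonempty
  -- The surplus of `M *ᵥ z` over `s • z` is positive everywhere; `ε` is its least relative size.
  set ε := (M ^ N *ᵥ r) i / z i
  have hε : 0 < ε := div_pos (hpos i) (hznn i)
  refine (lt_add_of_pos_right s hε).trans_le ?_
  refine le_spectralRadius_of_smul_le_mulVec hM (fun u => (hznn u).le)
    (fun h0 => (hznn w).ne' (congrFun h0 w)) (add_nonneg hs hε.le) fun u => ?_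
  have := (le_div_iff₀ (hznn u)).1 (hi u (Finset.mem_univ u))
  rw [hzr u, Pi.smul_apply, smul_eq_mul, add_mul]
  linarith

end CollatzWielandt

namespace Digraph

/-! ### The signless Laplacian as a nonnegative matrix -/

section Laplacian

variable {V : Type*} (D : Digraph V)

open Matrix

theorem signlessLaplacian_nonneg (i j : V) : 0 ≤ D.signlessLaplacian i j := by
  classical
  simp only [signlessLaplacian, adjMatrix, Matrix.add_apply, Matrix.diagonal_apply, Matrix.of_apply]
  positivity

variable {D} in
theorem signlessLaplacian_pos_of_adj {i j : V} (h : D.Adj i j) : 0 < D.signlessLaplacian i j := by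
  classical
  simp only [signlessLaplacian, adjMatrix, Matrix.add_apply, Matrix.diagonal_apply,
    Matrix.of_apply, if_pos h]
  positivity

variable [Fintype V]

open Classical in
theorem outDegree_eq_card (v : V) : D.outDegree v = (Finset.univ.filter (D.Adj v)).card := by
  rw [outDegree, ← Set.ncard_coe_finset]; simp

open Classical in
theorem signlessLaplacian_mulVec (y : V → ℝ) (v : V) :
    (D.signlessLaplacian *ᵥ y) v = ∑ w with D.Adj v w, (y v + y w) := by
  rw [signlessLaplacian, add_mulVec, Pi.add_apply, mulVec_diagonal, Finset.sum_add_distrib,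
    Finset.sum_const, outDegree_eq_card, nsmul_eq_mul, Finset.sum_filter (f := y)]
  simp [mulVec, dotProduct, adjMatrix]

variable {D}

theorem signlessLaplacian_diag_pos {i j : V} (h : D.Adj i j) : 0 < D.signlessLaplacian i i := by
  classical
  have : 0 < D.outDegree i := by
    rw [outDegree_eq_card]
    exact Finset.card_pos.2 ⟨j, by simpa using h⟩
  simp only [signlessLaplacian, adjMatrix, Matrix.add_apply, Matrix.diagonal_apply,
    Matrix.of_apply, if_true]
  positivity

theorem le_q_of_smul_le_mulVec {y : V → ℝ} (hy : 0 ≤ y) (hy0 : y ≠ 0) {s : ℝ} (hs : 0 ≤ s)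
    (h : s • y ≤ D.signlessLaplacian *ᵥ y) : s ≤ D.q := by
  classical
  exact le_spectralRadius_of_smul_le_mulVec D.signlessLaplacian_nonneg hy hy0 hs h

theorem q_le_of_mulVec_le_smul {y : V → ℝ} (hy : ∀ v, 0 < y v) {s : ℝ} (hs : 0 ≤ s)
    (h : D.signlessLaplacian *ᵥ y ≤ s • y) : D.q ≤ s := by
  classical
  exact spectralRadius_le_of_mulVec_le_smul D.signlessLaplacian_nonneg hy hs h

theorem q_eq_of_iso {W : Type*} [Fintype W] {E : Digraph W} (e : D.Adj ≃r E.Adj) : D.q = E.q := by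
  classical
  have hdeg : ∀ v, D.outDegree v = E.outDegree (e v) := fun v => by
    rw [outDegree, outDegree, ← Set.ncard_image_of_injective _ e.injective]
    congr 1
    ext w
    constructor
    · rintro ⟨x, hx, rfl⟩
      exact e.map_rel_iff.2 hx
    · intro hw
      refine ⟨e.symm w, ?_, e.apply_symm_apply w⟩
      rw [Set.mem_ofPred_eq, ← e.map_rel_iff, e.apply_symm_apply]
      exact hw
  have hmat : Matrix.reindexAlgEquiv ℂ ℂ e.toEquiv (D.signlessLaplacian.map (algebraMap ℝ ℂ)) =
      E.signlessLaplacian.map (algebraMap ℝ ℂ) := by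
    ext i j
    obtain ⟨i, rfl⟩ := e.surjective i
    obtain ⟨j, rfl⟩ := e.surjective j
    have hs : ∀ x, e.toEquiv.symm (e x) = x := e.toEquiv.symm_apply_apply
    simp [signlessLaplacian, adjMatrix, Matrix.diagonal_apply, hdeg, hs, e.map_rel_iff]
  unfold q spectralRadius
  rw [← hmat, AlgEquiv.spectrum_eq]

end Laplacian

/-! ### Distances to a vertex -/

section Distance

variable {V : Type*} (D : Digraph V)

/-- The vertices from which there is a directed walk of length `k` to `v`. -/
def walkSources (v : V) : ℕ → Set V
  | 0 => {v}
  | k + 1 => {w | ∃ x, D.Adj w x ∧ x ∈ walkSources v k}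

/-- The length of a shortest directed walk from `w` to `v` (with value `0` if there is none). -/
noncomputable def distTo (v w : V) : ℕ := sInf {k | w ∈ D.walkSources v k}

variable {D} {v : V}

theorem distTo_le {k : ℕ} {w : V} (h : w ∈ D.walkSources v k) : D.distTo v w ≤ k := Nat.sInf_le h

theorem mem_walkSources_distTo (hconn : D.IsStronglyConnected) (w : V) :
    w ∈ D.walkSources v (D.distTo v w) := by
  refine Nat.sInf_mem (s := {k | w ∈ D.walkSources v k}) ?_
  induction hconn w v using Relation.ReflTransGen.head_induction_on with
  | refl => exact ⟨0, rfl⟩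
  | head hab _ ih => exact ih.elim fun k hk => ⟨k + 1, _, hab, hk⟩

@[simp]
theorem distTo_self : D.distTo v v = 0 := Nat.le_zero.1 (distTo_le (k := 0) rfl)

/-- A shortest walk can be started with an arc towards a vertex that is nearer by one. -/
theorem exists_adj_distTo (hconn : D.IsStronglyConnected) {w : V} (hw : w ≠ v) :
    ∃ x, D.Adj w x ∧ D.distTo v x + 1 = D.distTo v w := by
  have h := mem_walkSources_distTo (v := v) hconn w
  have hmin : ∀ k, w ∈ D.walkSources v k → D.distTo v w ≤ k := fun k => distTo_le
  generalize D.distTo v w = d at h hmin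
  cases d with
  | zero => exact absurd h hw
  | succ k =>
    obtain ⟨x, hx, hxk⟩ := h
    refine ⟨x, hx, congrArg (· + 1) (le_antisymm (distTo_le hxk) ?_)⟩
    exact Nat.le_of_succ_le_succ (hmin _ ⟨x, hx, mem_walkSources_distTo hconn x⟩)

/-- All values between `0` and the distance of `w` are distances: they occur along a shortest walk
from `w`. -/
theorem exists_distTo_eq (hconn : D.IsStronglyConnected) (w : V) {k : ℕ}
    (hk : k ≤ D.distTo v w) : ∃ x, D.distTo v x = k := by
  induction hd : D.distTo v w generalizing w with
  | zero => exact ⟨w, by omega⟩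
  | succ d ih =>
    rcases hk.eq_or_lt with rfl | hlt
    · exact ⟨w, rfl⟩
    · have hw : w ≠ v := by rintro rfl; simp at hd
      obtain ⟨x, -, hx⟩ := exists_adj_distTo hconn hw
      exact ih x (by omega) (by omega)

theorem distTo_lt_card [Fintype V] (hconn : D.IsStronglyConnected) (w : V) :
    D.distTo v w < Fintype.card V := by
  classical
  have hsub : Finset.range (D.distTo v w + 1) ⊆ Finset.univ.image (D.distTo v) := fun k hk => by
    obtain ⟨x, hx⟩ := exists_distTo_eq (v := v) hconn w
      (Nat.lt_succ_iff.1 (Finset.mem_range.1 hk))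
    exact Finset.mem_image.2 ⟨x, Finset.mem_univ x, hx⟩
  have := (Finset.card_le_card hsub).trans Finset.card_image_le
  rwa [Finset.card_range, Finset.card_univ] at this

/-- If some vertex is as far from `v` as the number of vertices allows, then the distances to `v`
are pairwise distinct. -/
theorem distTo_injective [Fintype V] (hconn : D.IsStronglyConnected) {b : V}
    (hb : D.distTo v b + 1 = Fintype.card V) : Function.Injective (D.distTo v) := by
  classical
  let f : V → Fin (Fintype.card V) := fun w => ⟨D.distTo v w, distTo_lt_card hconn w⟩
  have hsurj : Function.Surjective f := fun k => by
    obtain ⟨x, hx⟩ := exists_distTo_eq (v := v) hconn b (k := k) (by omega)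
    exact ⟨x, Fin.ext hx⟩
  have hbij := (Fintype.bijective_iff_surjective_and_card f).2 ⟨hsurj, by simp⟩
  exact fun x y hxy => hbij.1 (Fin.ext hxy)

theorem mem_walkSources_of_cycle {k : ℕ} {c : Fin k → V}
    (hc : ∀ i, D.Adj (c i) (c (finRotate k i))) (l : ℕ) (j : Fin k) :
    c j ∈ D.walkSources (c ((finRotate k)^[l] j)) l := by
  induction l generalizing j with
  | zero => rfl
  | succ l ih => exact ⟨_, hc j, by simpa using ih (finRotate k j)⟩

theorem iterate_finRotate_self {k : ℕ} (i : Fin k) : (finRotate k)^[k] i = i := by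
  have := i.neZero
  have h : ∀ l : ℕ, (finRotate k)^[l] i = i + Fin.ofNat k l := fun l => by
    induction l with
    | zero => simp
    | succ l ih =>
      rw [Function.iterate_succ_apply', ih, finRotate_apply, add_assoc]
      congr 1
      ext
      simp [Fin.val_add]
  rw [h]
  ext
  simp

/-- In a strongly connected digraph, a cycle that misses a vertex can be left: some vertex `v` of
the cycle has an out-neighbour `a` on the cycle, from which the cycle leads back to `v`, and another
out-neighbour `b`. -/
theorem exists_branch_of_cycle [Fintype V] (hconn : D.IsStronglyConnected) {k : ℕ}
    (hk : k < Fintype.card V) (hcyc : D.HasDirectedCycle k) :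
    ∃ v a b, D.Adj v a ∧ D.Adj v b ∧ a ≠ b ∧ D.distTo v a + 1 ≤ k := by
  obtain ⟨hk1, c, -, hc⟩ := hcyc
  obtain ⟨u, hu⟩ : ∃ u, u ∉ Set.range c := by
    by_contra! h
    have := Fintype.card_le_of_surjective c h
    rw [Fintype.card_fin] at this
    omega
  obtain ⟨i, b, hib, hb⟩ : ∃ i b, D.Adj (c i) b ∧ b ∉ Set.range c := by
    by_contra! h
    refine hu ?_
    clear hu
    induction hconn (c ⟨0, hk1⟩) u with
    | refl => exact ⟨_, rfl⟩
    | tail _ hxy ih =>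
      obtain ⟨i, rfl⟩ := ih
      exact h i _ hxy
  refine ⟨c i, c (finRotate k i), b, hc i, hib, fun hab => hb ⟨_, hab⟩, ?_⟩
  have h := mem_walkSources_of_cycle hc (k - 1) (finRotate k i)
  rw [← Function.iterate_succ_apply, Nat.succ_eq_add_one, Nat.sub_add_cancel hk1,
    iterate_finRotate_self] at h
  have := distTo_le h
  omega

end Distance

/-! ### The extremal digraph -/

section Extremal

open Matrix

/-- The digraph `C_{n,g}` with its vertices numbered by the distance to the branching vertex `0`:
the arcs are `i → i - 1` for `i ≠ 0`, `0 → g - 1` and `0 → n - 1`. -/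
def cycleWithPathByDist (n g : ℕ) : Digraph (Fin n) where
  Adj i j := (j : ℕ) + 1 = i ∨ ((i : ℕ) = 0 ∧ ((j : ℕ) + 1 = g ∨ (j : ℕ) + 1 = n))

theorem nonempty_cycleWithPath_iso {n g : ℕ} (hg : 1 ≤ g) (hgn : g < n) :
    Nonempty ((cycleWithPath n g).Adj ≃r (cycleWithPathByDist n g).Adj) := by
  let f : Fin n → Fin n := fun i =>
    ⟨if (i : ℕ) < g then g - 1 - i else n + g - 1 - i, by split_ifs <;> omega⟩
  have hf : Function.Involutive f := fun i => by
    ext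
    have := i.isLt
    simp only [f]
    split_ifs <;> omega
  refine ⟨⟨hf.toPerm, fun {i j} => ?_⟩⟩
  have := i.isLt
  have := j.isLt
  simp only [Function.Involutive.coe_toPerm, cycleWithPathByDist, cycleWithPath, f]
  split_ifs <;> omega

/-- The number `t` for which `t + 1` is the signless Laplacian spectral radius of `C_{n,g}`. -/
theorem exists_one_lt_root {n g : ℕ} (hg : 2 ≤ g) (hgn : g < n) :
    ∃ t : ℝ, 1 < t ∧ t⁻¹ ^ (g - 1) + t⁻¹ ^ (n - 1) = t - 1 := by
  have hcont : ContinuousOn (fun t : ℝ => t - 1 - (t⁻¹ ^ (g - 1) + t⁻¹ ^ (n - 1)))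
      (Set.Icc 1 2) := by
    have hinv : ContinuousOn (fun t : ℝ => t⁻¹) (Set.Icc 1 2) :=
      continuousOn_id.inv₀ fun t ht => (zero_lt_one.trans_le ht.1).ne'
    fun_prop
  have hhalf : ∀ m : ℕ, 1 ≤ m → (2 : ℝ)⁻¹ ^ m ≤ 2⁻¹ := fun m hm => by
    simpa using pow_le_pow_of_le_one (by norm_num : (0 : ℝ) ≤ 2⁻¹) (by norm_num) hm
  have h1 := hhalf (g - 1) (by omega)
  have h2 := hhalf (n - 1) (by omega)
  obtain ⟨t, ht, hroot⟩ := intermediate_value_Icc (by norm_num) hcont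
    (show (0 : ℝ) ∈ _ from ⟨by norm_num, by norm_num at h1 h2 ⊢; linarith⟩)
  simp only at hroot
  refine ⟨t, lt_of_le_of_ne ht.1 ?_, by linarith⟩
  rintro rfl
  norm_num at hroot

theorem q_cycleWithPathByDist {n g : ℕ} (hg : 1 ≤ g) (hgn : g < n) {t : ℝ} (ht : 1 < t)
    (hroot : t⁻¹ ^ (g - 1) + t⁻¹ ^ (n - 1) = t - 1) : (cycleWithPathByDist n g).q = t + 1 := by
  classical
  have ht0 : 0 < t := zero_lt_one.trans ht
  set y : Fin n → ℝ := fun i => t⁻¹ ^ (i : ℕ) with hy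
  have hypos : ∀ i, 0 < y i := fun i => by positivity
  have heig : (cycleWithPathByDist n g).signlessLaplacian *ᵥ y = (t + 1) • y := by
    ext i
    rw [signlessLaplacian_mulVec, Pi.smul_apply, smul_eq_mul]
    rcases Nat.eq_zero_or_pos (i : ℕ) with hi | hi
    · have hN : Finset.univ.filter ((cycleWithPathByDist n g).Adj i) =
          {⟨g - 1, by omega⟩, ⟨n - 1, by omega⟩} := by
        ext j
        rw [Finset.mem_filter]
        simp only [cycleWithPathByDist, Finset.mem_univ, true_and, Finset.mem_insert,
          Finset.mem_singleton, Fin.ext_iff]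
        omega
      rw [hN, Finset.sum_pair (by simp only [ne_eq, Fin.mk.injEq]; omega)]
      simp only [hy, hi, pow_zero]
      linarith
    · have hN : Finset.univ.filter ((cycleWithPathByDist n g).Adj i) =
          {⟨(i : ℕ) - 1, by omega⟩} := by
        ext j
        rw [Finset.mem_filter]
        simp only [cycleWithPathByDist, Finset.mem_univ, true_and, Finset.mem_singleton, Fin.ext_iff]
        omega
      rw [hN, Finset.sum_singleton]
      obtain ⟨m, hm⟩ := Nat.exists_eq_add_of_lt hi
      have : y i = t⁻¹ ^ m * t⁻¹ := by simp only [hy]; rw [← pow_succ]; congr 1; omega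
      rw [this]
      simp only [hy, hm]
      have hm1 : 0 + m + 1 - 1 = m := by omega
      rw [hm1]
      field_simp
      ring
  refine le_antisymm
    (q_le_of_mulVec_le_smul hypos (by linarith) heig.le)
    (le_q_of_smul_le_mulVec (fun i => (hypos i).le)
      (fun h0 => (hypos ⟨0, by omega⟩).ne' (congrFun h0 _)) (by linarith) heig.ge)

end Extremal

/-! ### Comparison along distances -/

section Comparison

open Matrix

theorem inv_pow_distTo_of_succ {V : Type*} {D : Digraph V} {t : ℝ} {v w x : V}
    (ht : 1 < t) (h : D.distTo v x + 1 = D.distTo v w) :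
    (t + 1) * t⁻¹ ^ D.distTo v w = t⁻¹ ^ D.distTo v w + t⁻¹ ^ D.distTo v x := by
  have : t ≠ 0 := (zero_lt_one.trans ht).ne'
  rw [← h, pow_succ]
  field_simp
  ring

variable {V : Type*} [Fintype V] {D : Digraph V} {v a b : V} {g : ℕ} {t : ℝ}

/-- Summation over some out-neighbours bounds an entry of `Q(D) y` from below. -/
theorem sum_le_signlessLaplacian_mulVec {y : V → ℝ} (hy : ∀ w, 0 < y w) (w : V) (s : Finset V)
    (hs : ∀ x ∈ s, D.Adj w x) : ∑ x ∈ s, (y w + y x) ≤ (D.signlessLaplacian *ᵥ y) w := by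
  classical
  rw [signlessLaplacian_mulVec]
  exact Finset.sum_le_sum_of_subset_of_nonneg (fun x hx => by simpa using hs x hx)
    fun x _ _ => (add_pos (hy w) (hy x)).le

theorem sum_lt_signlessLaplacian_mulVec {y : V → ℝ} (hy : ∀ w, 0 < y w) {w : V} {s : Finset V}
    (hs : ∀ x ∈ s, D.Adj w x) {x : V} (hx : D.Adj w x) (hxs : x ∉ s) :
    ∑ x ∈ s, (y w + y x) < (D.signlessLaplacian *ᵥ y) w := by
  classical
  refine lt_of_lt_of_le ?_ (sum_le_signlessLaplacian_mulVec hy w (insert x s) fun z hz => ?_)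
  · rw [Finset.sum_insert hxs]
    linarith [add_pos (hy w) (hy x)]
  · rcases Finset.mem_insert.1 hz with rfl | hz
    exacts [hx, hs z hz]

/-- The test vector `w ↦ t⁻¹ ^ dist(w, v)` witnesses `t + 1 ≤ q(D)`: at `w ≠ v` an arc towards a
nearer vertex suffices, and at `v` the arcs to `a` and `b` do. -/
theorem smul_inv_pow_distTo_le (hconn : D.IsStronglyConnected) (ht : 1 < t)
    (hroot : t⁻¹ ^ (g - 1) + t⁻¹ ^ (Fintype.card V - 1) = t - 1)
    (hva : D.Adj v a) (hvb : D.Adj v b) (hab : a ≠ b) (ha : D.distTo v a + 1 ≤ g) :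
    (t + 1) • (fun w => t⁻¹ ^ D.distTo v w) ≤
      D.signlessLaplacian *ᵥ (fun w => t⁻¹ ^ D.distTo v w) := by
  classical
  have ht0 : 0 < t := zero_lt_one.trans ht
  have hy : ∀ w, 0 < t⁻¹ ^ D.distTo v w := fun w => by positivity
  intro w
  simp only [Pi.smul_apply, smul_eq_mul]
  by_cases hw : w = v
  · subst hw
    have h := sum_le_signlessLaplacian_mulVec (D := D) hy w {a, b} (by simp [hva, hvb])
    rw [Finset.sum_pair hab] at h
    have h1 : t⁻¹ ^ (g - 1) ≤ t⁻¹ ^ D.distTo w a :=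
      pow_le_pow_of_le_one (by positivity) (inv_le_one_of_one_le₀ ht.le) (by omega)
    have h2 : t⁻¹ ^ (Fintype.card V - 1) ≤ t⁻¹ ^ D.distTo w b := by
      have := distTo_lt_card (v := w) hconn b
      exact pow_le_pow_of_le_one (by positivity) (inv_le_one_of_one_le₀ ht.le) (by omega)
    refine le_trans ?_ h
    simp only [distTo_self, pow_zero]
    linarith
  · obtain ⟨x, hwx, hx⟩ := exists_adj_distTo hconn hw
    have h := sum_le_signlessLaplacian_mulVec (D := D) hy w {x} (by simpa using hwx)
    rw [Finset.sum_singleton] at h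
    rwa [inv_pow_distTo_of_succ ht hx]

/-- If the test vector is an eigenvector, then the distances to `v` number the vertices as in
`C_{n,g}`, since every arc beyond those used for the lower bound would make it strict. -/
theorem nonempty_iso_of_inv_pow_distTo_eq (hconn : D.IsStronglyConnected) (ht : 1 < t)
    (hroot : t⁻¹ ^ (g - 1) + t⁻¹ ^ (Fintype.card V - 1) = t - 1)
    (hva : D.Adj v a) (hvb : D.Adj v b) (hab : a ≠ b) (ha : D.distTo v a + 1 ≤ g)
    (heq : ∀ w, (D.signlessLaplacian *ᵥ (fun w => t⁻¹ ^ D.distTo v w)) w =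
      (t + 1) * t⁻¹ ^ D.distTo v w) :
    Nonempty (D.Adj ≃r (cycleWithPathByDist (Fintype.card V) g).Adj) := by
  classical
  have ht0 : 0 < t := zero_lt_one.trans ht
  have hy : ∀ w, 0 < t⁻¹ ^ D.distTo v w := fun w => by positivity
  have hinj : Function.Injective fun k : ℕ => t⁻¹ ^ k :=
    (pow_right_strictAnti₀ (by positivity) (inv_lt_one_of_one_lt₀ ht)).injective
  have hlt := distTo_lt_card (v := v) hconn b
  have h1 : t⁻¹ ^ (g - 1) ≤ t⁻¹ ^ D.distTo v a :=
    pow_le_pow_of_le_one (by positivity) (inv_le_one_of_one_le₀ ht.le) (by omega)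
  have h2 : t⁻¹ ^ (Fintype.card V - 1) ≤ t⁻¹ ^ D.distTo v b :=
    pow_le_pow_of_le_one (by positivity) (inv_le_one_of_one_le₀ ht.le) (by omega)
  have hv := heq v
  have hsum := sum_le_signlessLaplacian_mulVec (D := D) hy v {a, b} (by simp [hva, hvb])
  rw [hv, Finset.sum_pair hab] at hsum
  simp only [distTo_self, pow_zero] at hsum
  have hda : D.distTo v a = g - 1 := hinj (by simp only; linarith)
  have hdb : D.distTo v b = Fintype.card V - 1 := hinj (by simp only; linarith)
  have hNv : ∀ x, D.Adj v x → x = a ∨ x = b := fun x hx => by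
    by_contra hne
    have h := sum_lt_signlessLaplacian_mulVec (D := D) hy (s := {a, b}) (by simp [hva, hvb]) hx
      (by simpa using hne)
    rw [hv, Finset.sum_pair hab] at h
    simp only [distTo_self, pow_zero] at h
    linarith
  have hN : ∀ w, w ≠ v → ∀ x, D.Adj w x ↔ D.distTo v x + 1 = D.distTo v w := fun w hw x => by
    obtain ⟨z, hwz, hz⟩ := exists_adj_distTo hconn hw
    constructor
    · intro hwx
      by_cases hxz : x = z
      · rwa [hxz]
      · have h := sum_lt_signlessLaplacian_mulVec (D := D) hy (s := {z}) (by simpa using hwz) hwx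
          (by simpa using hxz)
        rw [heq w, Finset.sum_singleton, inv_pow_distTo_of_succ ht hz] at h
        exact absurd h (lt_irrefl _)
    · intro hx
      rwa [distTo_injective hconn (b := b) (v := v) (by omega)
        (show D.distTo v x = D.distTo v z by omega)]
  have hdinj : Function.Injective (D.distTo v) := distTo_injective hconn (b := b) (by omega)
  let f : V → Fin (Fintype.card V) := fun w => ⟨D.distTo v w, distTo_lt_card hconn w⟩
  have hf : Function.Bijective f := (Fintype.bijective_iff_injective_and_card f).2
    ⟨fun x y hxy => hdinj (congrArg Fin.val hxy), by simp⟩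
  refine ⟨⟨Equiv.ofBijective f hf, fun {w x} => ?_⟩⟩
  simp only [Equiv.ofBijective_apply, f, cycleWithPathByDist]
  by_cases hw : w = v
  · subst hw
    constructor
    · rintro (h | ⟨-, h | h⟩)
      · simp at h
      · rwa [hdinj (show D.distTo w x = D.distTo w a by omega)]
      · rwa [hdinj (show D.distTo w x = D.distTo w b by omega)]
    · intro h
      refine Or.inr ⟨distTo_self, ?_⟩
      rcases hNv x h with rfl | rfl <;> omega
  · have h0 : D.distTo v w ≠ 0 := fun h => hw (hdinj (h.trans distTo_self.symm))
    rw [hN w hw]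
    omega

/-- The lower bound on `q(D)` with its equality case: by irreducibility, equality makes the test
vector an eigenvector. -/
theorem add_one_le_q_and_nonempty_iso (hconn : D.IsStronglyConnected) (ht : 1 < t)
    (hroot : t⁻¹ ^ (g - 1) + t⁻¹ ^ (Fintype.card V - 1) = t - 1)
    (hg : g < Fintype.card V) (hcyc : D.HasDirectedCycle g) :
    t + 1 ≤ D.q ∧
      (D.q = t + 1 → Nonempty (D.Adj ≃r (cycleWithPathByDist (Fintype.card V) g).Adj)) := by
  classical
  have ht0 : 0 < t := zero_lt_one.trans ht
  obtain ⟨v, a, b, hva, hvb, hab, ha⟩ := exists_branch_of_cycle hconn hg hcyc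
  have hy : ∀ w, 0 < t⁻¹ ^ D.distTo v w := fun w => by positivity
  have hle := smul_inv_pow_distTo_le hconn ht hroot hva hvb hab ha
  refine ⟨le_q_of_smul_le_mulVec (fun w => (hy w).le)
    (fun h0 => (hy v).ne' (congrFun h0 v)) (by linarith) hle, fun hq => ?_⟩
  refine nonempty_iso_of_inv_pow_distTo_eq hconn ht hroot hva hvb hab ha fun w => ?_
  by_contra hne
  refine (lt_spectralRadius_of_smul_lt_mulVec D.signlessLaplacian_nonneg (fun u => ?_)
    (fun i j => Relation.ReflTransGen.mono (fun _ _ => signlessLaplacian_pos_of_adj)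
      _ _ (hconn i j)) hy (by linarith) hle
    (lt_of_le_of_ne (hle w) (Ne.symm hne))).ne' hq
  by_cases hu : u = v
  · exact hu ▸ signlessLaplacian_diag_pos hva
  · obtain ⟨x, hx, -⟩ := exists_adj_distTo hconn hu
    exact signlessLaplacian_diag_pos hx

end Comparison

end Digraph

theorem theorem5p2 {V : Type*} [Fintype V] (n g : ℕ) (hg : 2 ≤ g) (hgn : g < n)
    (D : Digraph V) (hcard : Fintype.card V = n) (hsimple : D.IsSimple)
    (hconn : D.IsStronglyConnected) (hgirth : D.girth = g) :
    (Digraph.cycleWithPath n g).q ≤ D.q ∧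
      2 < (Digraph.cycleWithPath n g).q ∧
      (D.q = (Digraph.cycleWithPath n g).q ↔
        Nonempty (D.Adj ≃r (Digraph.cycleWithPath n g).Adj)) := by
  have hcyc : D.HasDirectedCycle g := by
    -- The girth is positive, so it is not the value `0` of the infimum of the empty set.
    have h := Nat.sInf_mem (s := {k | D.HasDirectedCycle k})
      (Nat.nonempty_of_pos_sInf (by change 0 < D.girth; omega))
    exact hgirth ▸ h
  obtain ⟨t, ht, hroot⟩ := Digraph.exists_one_lt_root hg hgn
  obtain ⟨e⟩ := Digraph.nonempty_cycleWithPath_iso (by omega : 1 ≤ g) hgn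
  have hq : (Digraph.cycleWithPath n g).q = t + 1 := by
    rw [Digraph.q_eq_of_iso e, Digraph.q_cycleWithPathByDist (by omega) hgn ht hroot]
  subst hcard
  obtain ⟨hle, hiso⟩ := Digraph.add_one_le_q_and_nonempty_iso hconn ht hroot hgn hcyc
  refine ⟨hq.trans_le hle, by linarith, fun h => ?_, fun ⟨f⟩ => Digraph.q_eq_of_iso f⟩
  obtain ⟨f⟩ := hiso (h.trans hq)
  exact ⟨f.trans e.symm⟩
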